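/- Let $n\ge 0$ and let $\sigma\in S_n$ satisfy $\sigma^2=\mathrm{id}$ (so $\sigma=\mathrm{id}$ is allowed). Let $N_\sigma$ be the complex $n\times n$ matrix with $(N_\sigma)_{i,j}=1$ if $i<j$ and $\sigma(i)=j$, and $(N_\sigma)_{i,j}=0$ otherwise. Let $B\subset GL_n(\mathbb{C})$ be the group of invertible upper-triangular matrices and let $\mathcal{B}_\sigma=\{A N_\sigma A^{-1} : A\in B\}$ be the orbit of $N_\sigma$ under conjugation by $B$. The link pattern $P_\sigma$ consists of the points $1,\dots,n$ together with the arcs $(i,j)$, one for each pair with $i<j$ and $\sigma(i)=j$; a fixed point of $P_\sigma$ is a point $p$ with $\sigma(p)=p$. Let $\ell(P_\sigma)$ be the number of arcs; let $c(P_\sigma)$ be the number of crossings, that is, of pairs of arcs $(i,j),(i',j')$ with $i<i'<j<j'$; and let $f(P_\sigma)$ be the number of pairs consisting of a fixed point $p$ and an arc $(i,j)$ with $i<p<j$. **Theorem.** The dimension of $\mathcal{B}_\sigma$, with respect to the Zariski topology on complex $n\times n$ matrices, is $$\dim \mathcal{B}_\sigma=\ell(P_\sigma)\,(n-\ell(P_\sigma))-c(P_\sigma)-f(P_\sigma).$$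 -/

import Mathlib

namespace LinkPattern

/-! ### Upper-triangular matrices acting on square matrices by conjugation -/

/-- The Borel subgroup of upper-triangular matrices in `GL n ℂ`. -/
def borel (n : ℕ) : Subgroup (Matrix.GeneralLinearGroup (Fin n) ℂ) where
  carrier := {A | ∀ i j : Fin n, j < i → (A : Matrix (Fin n) (Fin n) ℂ) i j = 0}
  one_mem' := fun _ _ h => Matrix.one_apply_ne (ne_of_gt h)
  mul_mem' := by
    intro A B hA hB
    have hA' : (A : Matrix (Fin n) (Fin n) ℂ).BlockTriangular id := fun i j h => hA i j h
    have hB' : (B : Matrix (Fin n) (Fin n) ℂ).BlockTriangular id := fun i j h => hB i j h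
    exact fun i j h => (hA'.mul hB') h
  inv_mem' := by
    intro A hA i j h
    have hA' : (A : Matrix (Fin n) (Fin n) ℂ).BlockTriangular id := fun i j h => hA i j h
    have : Invertible (A : Matrix (Fin n) (Fin n) ℂ) := Units.invertible A
    have h2 := Matrix.blockTriangular_inv_of_blockTriangular hA'
    rw [Matrix.coe_units_inv]
    exact h2 h

/-- The orbit `{A u A⁻¹ | A ∈ B}` of a matrix `u` under conjugation by the Borel subgroup. -/
def borelOrbit {n : ℕ} (u : Matrix (Fin n) (Fin n) ℂ) : Set (Matrix (Fin n) (Fin n) ℂ) :=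
  {v | ∃ A ∈ borel n, v = (A : Matrix (Fin n) (Fin n) ℂ) * u *
    ((A⁻¹ : Matrix.GeneralLinearGroup (Fin n) ℂ) : Matrix (Fin n) (Fin n) ℂ)}

/-- The matrix `N_σ`: the permutation matrix of `σ` with the diagonal and everything below it
erased. -/
def nilMatrix {n : ℕ} (σ : Equiv.Perm (Fin n)) : Matrix (Fin n) (Fin n) ℂ :=
  Matrix.of fun i j => if i < j ∧ σ i = j then 1 else 0

/-! ### Dimension for the Zariski topology -/

/-- The common zeros, in the affine space of `n × n` complex matrices, of a set of polynomials in
the matrix entries. -/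
def matrixZeros {n : ℕ} (S : Set (MvPolynomial (Fin n × Fin n) ℂ)) :
    Set (Matrix (Fin n) (Fin n) ℂ) :=
  {M | ∀ p ∈ S, MvPolynomial.eval (fun ij => M ij.1 ij.2) p = 0}

/-- The Zariski topology on `n × n` complex matrices: the closed sets are the zero sets of sets of
polynomials in the entries. It is not an instance, since matrices over `ℂ` already carry the
Euclidean topology. -/
@[reducible] def zariskiTopology (n : ℕ) : TopologicalSpace (Matrix (Fin n) (Fin n) ℂ) :=
  TopologicalSpace.ofClosed {Z | ∃ S : Set (MvPolynomial (Fin n × Fin n) ℂ), Z = matrixZeros S}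
    ⟨{1}, by ext M; simp [matrixZeros]⟩
    (by
      intro A hA
      refine ⟨{p | ∃ S, matrixZeros S ∈ A ∧ p ∈ S}, ?_⟩
      ext M
      simp only [Set.mem_sInter, matrixZeros, Set.mem_ofPred_eq]
      constructor
      · rintro h p ⟨S, hS, hp⟩
        exact h _ hS p hp
      · intro h Z hZ
        obtain ⟨S, rfl⟩ := hA hZ
        exact fun p hp => h p ⟨S, hZ, hp⟩)
    (by
      rintro _ ⟨S, rfl⟩ _ ⟨T, rfl⟩
      refine ⟨{r | ∃ p ∈ S, ∃ q ∈ T, r = p * q}, ?_⟩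
      ext M
      simp only [Set.mem_union, matrixZeros, Set.mem_ofPred_eq]
      constructor
      · rintro (h | h) r ⟨p, hp, q, hq, rfl⟩
        · simp [h p hp]
        · simp [h q hq]
      · intro h
        by_contra hcon
        push Not at hcon
        obtain ⟨⟨p, hp, hp0⟩, q, hq, hq0⟩ := hcon
        have := h _ ⟨p, hp, q, hq, rfl⟩
        rw [map_mul] at this
        exact (mul_ne_zero hp0 hq0) this)

/-- The closed sets of the Zariski topology are exactly the zero sets of polynomials. -/
theorem isClosed_zariskiTopology_iff {n : ℕ} (Z : Set (Matrix (Fin n) (Fin n) ℂ)) :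
    @IsClosed _ (zariskiTopology n) Z ↔
      ∃ S : Set (MvPolynomial (Fin n × Fin n) ℂ), Z = matrixZeros S := by
  rw [← @isOpen_compl_iff _ _ (zariskiTopology n)]
  change Zᶜᶜ ∈ {Z | ∃ S : Set (MvPolynomial (Fin n × Fin n) ℂ), Z = matrixZeros S} ↔ _
  rw [compl_compl]
  rfl

/-- The dimension of a set `V` of matrices: its Krull dimension (supremum of the lengths of chains
of irreducible closed subsets) as a topological space with the subspace topology of the Zariski
topology. -/
noncomputable def zariskiDim {n : ℕ} (V : Set (Matrix (Fin n) (Fin n) ℂ)) : WithBot ℕ∞ :=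
  @topologicalKrullDim V (TopologicalSpace.induced Subtype.val (zariskiTopology n))

/-! ### The link pattern of an involution -/

/-- The arcs of the link pattern of `σ`: the pairs `(i, j)` with `i < j` and `σ i = j`. -/
def arcs {n : ℕ} (σ : Equiv.Perm (Fin n)) : Finset (Fin n × Fin n) :=
  Finset.univ.filter fun a => a.1 < a.2 ∧ σ a.1 = a.2

/-- The number of arcs. -/
def length {n : ℕ} (σ : Equiv.Perm (Fin n)) : ℕ := (arcs σ).card

/-- The number of crossings: pairs of arcs `(i, j)`, `(i', j')` with `i < i' < j < j'`. Each
crossing is counted once, since `i < i'` orders the two arcs. -/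
def crossings {n : ℕ} (σ : Equiv.Perm (Fin n)) : ℕ :=
  ((arcs σ ×ˢ arcs σ).filter fun p =>
    p.1.1 < p.2.1 ∧ p.2.1 < p.1.2 ∧ p.1.2 < p.2.2).card

/-- The fixed points of the link pattern. -/
def fixedPts {n : ℕ} (σ : Equiv.Perm (Fin n)) : Finset (Fin n) :=
  Finset.univ.filter fun p => σ p = p

/-- The number of arcs `(i, j)` over the point `p`, that is with `i < p < j`. -/
def arcsOver {n : ℕ} (σ : Equiv.Perm (Fin n)) (p : Fin n) : ℕ :=
  ((arcs σ).filter fun a => a.1 < p ∧ p < a.2).card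

/-- The sum over all fixed points of the number of arcs over the fixed point. -/
def fixedUnder {n : ℕ} (σ : Equiv.Perm (Fin n)) : ℕ :=
  ∑ p ∈ fixedPts σ, arcsOver σ p

end LinkPattern

/-! Write `N` for `nilMatrix σ` and `ℓ` for the number of arcs. The orbit is parametrized
bijectively by an affine space with some coordinates required to be nonzero, with the map and its
inverse both given by regular functions; the dimension is then the number of coordinates.

For upper triangular invertible `A`, the matrix `A N A⁻¹` is the sum, over right ends `k`, of the
product of column `σ k` of `A` and row `k` of `A⁻¹`. So only the left-end columns of `A` and the
right-end rows of `A⁻¹` matter. The centralizer of `N` can be used to clear the entry of `A` at `(x,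
y)` when `x < y` are left ends with `σ x < σ y`, and to normalize the diagonal entries in left-end
columns. The remaining columns may be replaced by ones that are trivial outside the right-end rows.
The surviving entries form a slice that meets every class of matrices `A` giving the same conjugate
(`range_orbitMap`).

On the slice, the sum above is a factorization of lower-unitriangular times upper-triangular type,
so Gaussian elimination recovers the slice entries as regular functions of the conjugate
(`regular_coord_of_orbitMap`). This makes the parametrization a homeomorphism onto the orbit, and
`zariskiDim_eq_card` applies.

Finally the free positions are matched with pairs consisting of a right end and a point that is not
a left end. There are `ℓ (n - ℓ)` such pairs, and the ones missed are exactly the crossings and the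
fixed points under arcs (`card_slicePositions_add`). -/

namespace LinkPattern

/-! ### Regular functions and pulled-back Zariski topologies. -/

section Regular

variable {α κ : Type*}

/-- The functions `g` on `α` of the form `p(φ) / q(φ)`, with `p`, `q` polynomials and `q(φ)` nowhere
zero: the functions that are regular with respect to a map `φ` to an affine space. -/
def regularFunctions (φ : α → κ → ℂ) : Subalgebra ℂ (α → ℂ) where
  carrier := {g | ∃ p q : MvPolynomial κ ℂ, ∀ a, MvPolynomial.eval (φ a) q ≠ 0 ∧
    g a * MvPolynomial.eval (φ a) q = MvPolynomial.eval (φ a) p}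
  mul_mem' := by
    rintro g h ⟨p, q, hg⟩ ⟨p', q', hh⟩
    refine ⟨p * p', q * q', fun a => ⟨?_, ?_⟩⟩
    · simpa using ⟨(hg a).1, (hh a).1⟩
    · simp only [map_mul, ← (hg a).2, ← (hh a).2, Pi.mul_apply]; ring
  add_mem' := by
    rintro g h ⟨p, q, hg⟩ ⟨p', q', hh⟩
    refine ⟨p * q' + p' * q, q * q', fun a => ⟨?_, ?_⟩⟩
    · simpa using ⟨(hg a).1, (hh a).1⟩
    · simp only [map_mul, map_add, ← (hg a).2, ← (hh a).2, Pi.add_apply]; ring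
  algebraMap_mem' r := ⟨MvPolynomial.C r, 1, fun a => by simp⟩

theorem coord_mem_regularFunctions (φ : α → κ → ℂ) (k : κ) :
    (fun a => φ a k) ∈ regularFunctions φ :=
  ⟨MvPolynomial.X k, 1, fun a => by simp⟩

theorem const_mem_regularFunctions (φ : α → κ → ℂ) (c : ℂ) :
    (fun _ => c) ∈ regularFunctions φ :=
  (regularFunctions φ).algebraMap_mem c

theorem div_mem_regularFunctions {φ : α → κ → ℂ} {g h : α → ℂ} (hg : g ∈ regularFunctions φ)
    (hh : h ∈ regularFunctions φ) (h0 : ∀ a, h a ≠ 0) :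
    (fun a => g a / h a) ∈ regularFunctions φ := by
  obtain ⟨p, q, hg⟩ := hg
  obtain ⟨p', q', hh⟩ := hh
  refine ⟨p * q', q * p', fun a => ⟨?_, ?_⟩⟩
  · simpa [← (hh a).2] using ⟨(hg a).1, h0 a, (hh a).1⟩
  · have := h0 a
    simp only [map_mul, ← (hg a).2, ← (hh a).2]; field_simp

theorem sum_mul_mem_regularFunctions {φ : α → κ → ℂ} {ι : Type*} (s : Finset ι)
    {f g : α → ι → ℂ} (hf : ∀ i ∈ s, (fun a => f a i) ∈ regularFunctions φ)
    (hg : ∀ i ∈ s, (fun a => g a i) ∈ regularFunctions φ) :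
    (fun a => ∑ i ∈ s, f a i * g a i) ∈ regularFunctions φ := by
  have := Subalgebra.sum_mem (regularFunctions φ) fun i hi => mul_mem (hf i hi) (hg i hi)
  convert this using 1
  ext a
  simp

theorem sub_mem_regularFunctions {φ : α → κ → ℂ} {g h : α → ℂ} (hg : g ∈ regularFunctions φ)
    (hh : h ∈ regularFunctions φ) : (fun a => g a - h a) ∈ regularFunctions φ :=
  sub_mem hg hh

theorem eval_mem_regularFunctions {μ : Type*} {φ : α → κ → ℂ} {ψ : α → μ → ℂ}
    (h : ∀ m, (fun a => ψ a m) ∈ regularFunctions φ) (p : MvPolynomial μ ℂ) :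
    (fun a => MvPolynomial.eval (ψ a) p) ∈ regularFunctions φ := by
  induction p using MvPolynomial.induction_on with
  | C r => simpa using const_mem_regularFunctions φ r
  | add p q hp hq =>
    simp only [map_add]
    exact add_mem hp hq
  | mul_X p m hp =>
    simp only [map_mul, MvPolynomial.eval_X]
    exact mul_mem hp (h m)

/-- The topology on `α` obtained by pulling back the Zariski topology of an affine space. -/
@[reducible] noncomputable def pullbackZariski (φ : α → κ → ℂ) : TopologicalSpace α :=
  TopologicalSpace.induced
    (fun a => MvPolynomial.pointToPoint (k := ℂ) (φ a)) PrimeSpectrum.zariskiTopology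

theorem isClosed_pullbackZariski_iff (φ : α → κ → ℂ) (Z : Set α) :
    @IsClosed _ (pullbackZariski φ) Z ↔
      ∃ S : Set (MvPolynomial κ ℂ), Z = {a | ∀ p ∈ S, MvPolynomial.eval (φ a) p = 0} := by
  have key (S : Set (MvPolynomial κ ℂ)) :
      (fun a => MvPolynomial.pointToPoint (k := ℂ) (φ a)) ⁻¹' PrimeSpectrum.zeroLocus S =
        {a | ∀ p ∈ S, MvPolynomial.eval (φ a) p = 0} := by
    ext a
    have : ∀ p : MvPolynomial κ ℂ, p ∈ (MvPolynomial.pointToPoint (k := ℂ) (φ a)).asIdeal ↔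
        MvPolynomial.eval (φ a) p = 0 :=
      fun p => MvPolynomial.mem_vanishingIdeal_singleton_iff (k := ℂ) (φ a) p
    simp [PrimeSpectrum.mem_zeroLocus, Set.subset_def, this]
  rw [isClosed_induced_iff]
  constructor
  · rintro ⟨t, ht, rfl⟩
    obtain ⟨S, rfl⟩ := (PrimeSpectrum.isClosed_iff_zeroLocus _).1 ht
    exact ⟨S, key S⟩
  · rintro ⟨S, rfl⟩
    exact ⟨_, PrimeSpectrum.isClosed_zeroLocus S, key S⟩

/-- Regular maps are continuous: a polynomial in `ψ` is a fraction in `φ` with nowhere vanishing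
denominator, so its zeros are those of the numerator. Used in both directions, this identifies the
topology of the parameter space with that of its image. -/
theorem pullbackZariski_mono {μ : Type*} {φ : α → κ → ℂ} {ψ : α → μ → ℂ}
    (h : ∀ m, (fun a => ψ a m) ∈ regularFunctions φ) : pullbackZariski φ ≤ pullbackZariski ψ := by
  rw [TopologicalSpace.le_def]
  intro U hU
  rw [← compl_compl U, @isOpen_compl_iff _ _ (pullbackZariski ψ)] at hU
  rw [← compl_compl U, @isOpen_compl_iff _ _ (pullbackZariski φ)]
  obtain ⟨S, hS⟩ := (isClosed_pullbackZariski_iff ψ _).1 hU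
  refine (isClosed_pullbackZariski_iff φ _).2
    ⟨{p | ∃ s ∈ S, ∃ q : MvPolynomial κ ℂ, ∀ a, MvPolynomial.eval (φ a) q ≠ 0 ∧
      MvPolynomial.eval (ψ a) s * MvPolynomial.eval (φ a) q = MvPolynomial.eval (φ a) p}, ?_⟩
  rw [hS]
  ext a
  constructor
  · rintro ha p ⟨s, hs, q, hq⟩
    rw [← (hq a).2, ha s hs, zero_mul]
  · intro ha s hs
    obtain ⟨p, q, hpq⟩ := eval_mem_regularFunctions h s
    have := ha p ⟨s, hs, q, hpq⟩
    rw [← (hpq a).2] at this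
    exact (mul_eq_zero.1 this).resolve_right (hpq a).1

end Regular

/-! ### Krull dimension of an affine space minus coordinate hyperplanes. -/

section Dimension

variable {κ : Type*}

/-- The complement in an affine space of the coordinate hyperplanes indexed by `P`. -/
abbrev CoordNeZero (P : κ → Prop) : Type _ := {t : κ → ℂ // ∀ k, P k → t k ≠ 0}

theorem isPreirreducible_coordSubspace [Fintype κ] (P : κ → Prop) (s : Finset κ) :
    @IsPreirreducible _ (pullbackZariski (Subtype.val : CoordNeZero P → κ → ℂ))
      {t | ∀ k ∉ s, t.1 k = 1} := by
  classical
  let := pullbackZariski (Subtype.val : CoordNeZero P → κ → ℂ)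
  rw [isPreirreducible_iff_isClosed_union_isClosed]
  intro z₁ z₂ h₁ h₂ hsub
  obtain ⟨S, rfl⟩ := (isClosed_pullbackZariski_iff (Subtype.val : CoordNeZero P → κ → ℂ) _).1 h₁
  obtain ⟨S', rfl⟩ := (isClosed_pullbackZariski_iff (Subtype.val : CoordNeZero P → κ → ℂ) _).1 h₂
  -- Substituting 1 for the variables outside `s` restricts polynomials to the coordinate subspace.
  let e : κ → MvPolynomial κ ℂ := fun k => if k ∈ s then MvPolynomial.X k else 1
  let sub : MvPolynomial κ ℂ →ₐ[ℂ] MvPolynomial κ ℂ := MvPolynomial.aeval e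
  have heval (x : κ → ℂ) (p : MvPolynomial κ ℂ) : MvPolynomial.eval x (sub p) =
      MvPolynomial.eval (fun k => if k ∈ s then x k else 1) p := by
    induction p using MvPolynomial.induction_on with
    | C r => simp [sub]
    | add p q hp hq => simp [hp, hq]
    | mul_X p k hp =>
      rw [map_mul, map_mul, hp, map_mul]
      congr 1
      simp only [sub, e, MvPolynomial.aeval_X, MvPolynomial.eval_X]
      split_ifs <;> simp
  by_contra! hcon
  obtain ⟨hcon₁, hcon₂⟩ := hcon
  simp only [Set.not_subset, Set.mem_ofPred_eq, not_forall] at hcon₁ hcon₂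
  obtain ⟨t, ht, p, hp, hpt⟩ := hcon₁
  obtain ⟨t', ht', p', hp', hpt'⟩ := hcon₂
  have hne {t : CoordNeZero P} (ht : ∀ k ∉ s, t.1 k = 1) {p : MvPolynomial κ ℂ}
      (hpt : ¬ MvPolynomial.eval t.1 p = 0) : sub p ≠ 0 := by
    intro h0
    apply hpt
    have := heval t.1 p
    rw [h0, map_zero] at this
    refine Eq.trans ?_ this.symm
    congr 2
    ext k
    split_ifs with hk
    · rfl
    · rw [ht k hk]
  have hX : (∏ k ∈ s, (MvPolynomial.X k : MvPolynomial κ ℂ)) ≠ 0 :=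
    Finset.prod_ne_zero_iff.2 fun k _ => MvPolynomial.X_ne_zero k
  -- The factor `∏ X k` makes the product vanish also at points with a zero coordinate in `s`, which
  -- the covering `hsub` does not control.
  refine mul_ne_zero (mul_ne_zero (hne ht hpt) (hne ht' hpt')) hX (MvPolynomial.funext fun x => ?_)
  rw [map_mul, map_mul, map_zero, heval, heval, MvPolynomial.eval_prod]
  by_cases hx : ∀ k ∈ s, x k ≠ 0
  · have hmem : (⟨fun k => if k ∈ s then x k else 1, fun k _ => by
        dsimp only; split_ifs with hk; exacts [hx k hk, one_ne_zero]⟩ : CoordNeZero P) ∈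
        {t : CoordNeZero P | ∀ k ∉ s, t.1 k = 1} := fun k hk => if_neg hk
    rcases hsub hmem with h | h
    · rw [h p hp]; simp
    · rw [h p' hp']; simp
  · push Not at hx
    obtain ⟨k, hk, hk0⟩ := hx
    rw [Finset.prod_eq_zero hk (by simpa using hk0), mul_zero]

theorem card_le_krullDim_finset [Fintype κ] :
    ((Fintype.card κ : ℕ) : WithBot ℕ∞) ≤ Order.krullDim (Finset κ) := by
  let e := Fintype.equivFin κ
  have hmono : StrictMono fun i : Fin (Fintype.card κ + 1) =>
      (Finset.univ.filter fun k => (e k : ℕ) < i : Finset κ) := by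
    rw [Fin.strictMono_iff_lt_succ]
    intro i
    rw [Finset.ssubset_iff_of_subset]
    · exact ⟨e.symm i, by simp, by simp⟩
    · intro k
      simp only [Finset.mem_filter, Finset.mem_univ, true_and, Fin.val_castSucc, Fin.val_succ]
      omega
  exact Order.LTSeries.length_le_krullDim (LTSeries.mk (Fintype.card κ) _ hmono)

/-- The upper bound comes from embedding the topology in the prime spectrum of a polynomial ring.
The lower bound comes from coordinate subspaces through the point with all coordinates 1, which
avoids the removed hyperplanes. -/
theorem topologicalKrullDim_coordNeZero [Fintype κ] (P : κ → Prop) :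
    @topologicalKrullDim _ (pullbackZariski (Subtype.val : CoordNeZero P → κ → ℂ)) =
      (Fintype.card κ : ℕ) := by
  classical
  let := pullbackZariski (Subtype.val : CoordNeZero P → κ → ℂ)
  apply le_antisymm
  · have hind : Topology.IsInducing
        (fun t : CoordNeZero P => MvPolynomial.pointToPoint (k := ℂ) t.1) := ⟨rfl⟩
    refine hind.topologicalKrullDim_le.trans ?_
    rw [PrimeSpectrum.topologicalKrullDim_eq_ringKrullDim,
      MvPolynomial.ringKrullDim_of_isNoetherianRing]
    simp
  · refine card_le_krullDim_finset.trans ?_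
    let F : Finset κ → TopologicalSpace.IrreducibleCloseds (CoordNeZero P) := fun s =>
      { carrier := {t | ∀ k ∉ s, t.1 k = 1}
        isIrreducible' := ⟨⟨⟨fun _ => 1, fun _ _ => one_ne_zero⟩, fun _ _ => rfl⟩,
          isPreirreducible_coordSubspace P s⟩
        isClosed' := (isClosed_pullbackZariski_iff (Subtype.val : CoordNeZero P → κ → ℂ) _).2
          ⟨{p | ∃ k ∉ s, p = MvPolynomial.X k - 1}, by
            ext t
            constructor
            · rintro ht p ⟨k, hk, rfl⟩
              simp [ht k hk]
            · intro ht k hk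
              simpa [sub_eq_zero] using ht _ ⟨k, hk, rfl⟩⟩ }
    have hF : ∀ s s', F s ≤ F s' ↔ s ≤ s' := by
      intro s s'
      constructor
      · intro h k hk
        by_contra hk'
        -- The value 2 only has to differ from both 0 and 1.
        have hmem : (⟨Function.update (fun _ => 1) k 2, fun j _ => by
            by_cases hj : j = k <;> simp [hj]⟩ : CoordNeZero P) ∈ F s := by
          intro j hj
          have : j ≠ k := fun h => hj (h ▸ hk)
          simp [this]
        simpa using (h hmem : ∀ j ∉ s', _) k hk'
      · intro h t ht k hk
        exact ht k fun hks => hk (h hks)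
    refine Order.krullDim_le_of_strictMono F fun s s' h => ?_
    rw [lt_iff_le_not_ge, hF, hF]
    exact ⟨h.le, h.not_ge⟩

/-- A bijective parametrization of a set `V` of matrices by an open subset of an affine space, which
is regular in both directions, determines the dimension of `V`. -/
theorem zariskiDim_eq_card [Fintype κ] {n : ℕ} (P : κ → Prop)
    (Φ : CoordNeZero P → Matrix (Fin n) (Fin n) ℂ)
    (hΦ : ∀ ij : Fin n × Fin n, (fun t => Φ t ij.1 ij.2) ∈
      regularFunctions (Subtype.val : CoordNeZero P → κ → ℂ))
    (hinv : ∀ k, (fun t : CoordNeZero P => t.1 k) ∈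
      regularFunctions (fun t (ij : Fin n × Fin n) => Φ t ij.1 ij.2)) :
    zariskiDim (Set.range Φ) = (Fintype.card κ : ℕ) := by
  rw [← topologicalKrullDim_coordNeZero P]
  have htop := le_antisymm (pullbackZariski_mono hΦ) (pullbackZariski_mono hinv)
  let := pullbackZariski (Subtype.val : CoordNeZero P → κ → ℂ)
  let := zariskiTopology n
  have hind : Topology.IsInducing Φ := by
    refine ⟨htop.trans (TopologicalSpace.ext_isClosed fun Z => ?_)⟩
    rw [isClosed_pullbackZariski_iff, isClosed_induced_iff]
    constructor
    · rintro ⟨S, rfl⟩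
      exact ⟨matrixZeros S, (isClosed_zariskiTopology_iff _).2 ⟨S, rfl⟩, rfl⟩
    · rintro ⟨t, ht, rfl⟩
      obtain ⟨S, rfl⟩ := (isClosed_zariskiTopology_iff _).1 ht
      exact ⟨S, rfl⟩
  have hinj : Function.Injective Φ := by
    intro t t' h
    ext k
    obtain ⟨p, q, hpq⟩ := hinv k
    have h1 := hpq t
    have h2 := hpq t'
    simp only [← h] at h2
    exact mul_right_cancel₀ h1.1 (h1.2.trans h2.2.symm)
  have hhomeo : IsHomeomorph (Set.rangeFactorization Φ) := by
    rw [isHomeomorph_iff_isEmbedding_surjective]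
    refine ⟨⟨?_, fun a b h => hinj (congrArg Subtype.val h)⟩, Set.rangeFactorization_surjective⟩
    exact (Topology.IsInducing.subtypeVal.of_comp_iff (f := Set.rangeFactorization Φ)).1 hind
  exact (hhomeo.topologicalKrullDim_eq _).symm

end Dimension

end LinkPattern

namespace LinkPattern

/-! ### Upper triangular inverses, back substitution and Gaussian elimination. -/

section Triangular

variable {n : ℕ} {M : Matrix (Fin n) (Fin n) ℂ}

theorem isUnit_det_of_upper (hM : ∀ i j, j < i → M i j = 0) (hd : ∀ i, M i i ≠ 0) :
    IsUnit M.det := by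
  rw [Matrix.det_of_isUpperTriangular fun i j h => hM i j h, isUnit_iff_ne_zero]
  exact Finset.prod_ne_zero_iff.2 fun i _ => hd i

theorem inv_upper (hM : ∀ i j, j < i → M i j = 0) (hd : ∀ i, M i i ≠ 0) :
    ∀ i j, j < i → M⁻¹ i j = 0 := by
  have : Invertible M := Matrix.invertibleOfIsUnitDet _ (isUnit_det_of_upper hM hd)
  have hM' : M.BlockTriangular id := fun i j h => hM i j h
  exact fun i j h => Matrix.blockTriangular_inv_of_blockTriangular hM' h

theorem mul_diag_of_upper {M' : Matrix (Fin n) (Fin n) ℂ} (hM : ∀ i j, j < i → M i j = 0)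
    (hM' : ∀ i j, j < i → M' i j = 0) (i : Fin n) : (M * M') i i = M i i * M' i i := by
  rw [Matrix.mul_apply, Finset.sum_eq_single i]
  · intro j _ hj
    rcases lt_or_gt_of_ne hj with h | h
    · rw [hM _ _ h, zero_mul]
    · rw [hM' _ _ h, mul_zero]
  · simp

theorem inv_diag_ne_zero (hM : ∀ i j, j < i → M i j = 0) (hd : ∀ i, M i i ≠ 0) (i : Fin n) :
    M⁻¹ i i ≠ 0 := by
  have h := mul_diag_of_upper hM (inv_upper hM hd) i
  rw [Matrix.mul_nonsing_inv _ (isUnit_det_of_upper hM hd), Matrix.one_apply_eq] at h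
  exact right_ne_zero_of_mul_eq_one h.symm

/-- Back substitution: a vector that satisfies upper triangular equations in the rows in `S`, and
whose other entries are regular, has regular entries. -/
theorem regular_of_upper_system {α κ : Type*} {φ : α → κ → ℂ} (S : Set (Fin n))
    (M : α → Matrix (Fin n) (Fin n) ℂ) (v w : α → Fin n → ℂ)
    (hM : ∀ a, ∀ x ∈ S, ∀ z < x, M a x z = 0) (hd : ∀ a, ∀ x ∈ S, M a x x ≠ 0)
    (heq : ∀ a, ∀ x ∈ S, ∑ z, M a x z * v a z = w a x)
    (hMr : ∀ x ∈ S, ∀ z, (fun a => M a x z) ∈ regularFunctions φ)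
    (hw : ∀ x ∈ S, (fun a => w a x) ∈ regularFunctions φ)
    (hv : ∀ x ∉ S, (fun a => v a x) ∈ regularFunctions φ) (x : Fin n) :
    (fun a => v a x) ∈ regularFunctions φ := by
  induction x using WellFoundedGT.induction with
  | ind x ih =>
    by_cases hx : x ∈ S
    · have hsol : (fun a => v a x) =
          fun a => (w a x - ∑ z ∈ Finset.Ioi x, M a x z * v a z) / M a x x := by
        ext a
        rw [eq_div_iff (hd a x hx), ← heq a x hx, eq_sub_iff_add_eq]
        have hsub : ∑ z ∈ Finset.Ici x, M a x z * v a z = ∑ z, M a x z * v a z := by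
          refine Finset.sum_subset (Finset.subset_univ _) fun z _ hz => ?_
          rw [hM a x hx z (by simpa using hz), zero_mul]
        rw [← hsub, ← Finset.Ioi_insert, Finset.sum_insert (by simp), mul_comm (v a x)]
      rw [hsol]
      refine div_mem_regularFunctions (sub_mem_regularFunctions (hw x hx)
        (sum_mul_mem_regularFunctions _ (fun z _ => hMr x hx z) fun z hz => ih z ?_))
        (hMr x hx x) fun a => hd a x hx
      simpa using hz
    · exact hv x hx

theorem regular_inv_of_upper {α κ : Type*} {φ : α → κ → ℂ}
    (M : α → Matrix (Fin n) (Fin n) ℂ)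
    (hM : ∀ a i j, j < i → M a i j = 0) (hd : ∀ a i, M a i i ≠ 0)
    (hMr : ∀ i j, (fun a => M a i j) ∈ regularFunctions φ) (i j : Fin n) :
    (fun a => (M a)⁻¹ i j) ∈ regularFunctions φ := by
  refine regular_of_upper_system Set.univ M (fun a z => (M a)⁻¹ z j)
    (fun _ x => (1 : Matrix (Fin n) (Fin n) ℂ) x j) (fun a x _ z h => hM a x z h)
    (fun a x _ => hd a x) (fun a x _ => ?_) (fun x _ z => hMr x z)
    (fun x _ => const_mem_regularFunctions φ _) (fun x hx => (hx trivial).elim) i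
  rw [← Matrix.mul_apply, Matrix.mul_nonsing_inv _ (isUnit_det_of_upper (hM a) (hd a))]

/-- Gaussian elimination: the entries of the factors of a matrix with a factorization of
lower-unitriangular times upper-triangular type are regular functions of the product. -/
theorem regular_of_lu {α κ : Type*} {φ : α → κ → ℂ} (s : Finset (Fin n)) (τ : Fin n → Fin n)
    (P : α → Fin n → Fin n → ℂ) (D X : α → Matrix (Fin n) (Fin n) ℂ) (hX : ∀ a x y, X a x y = ∑ k ∈ s, P a x k * D a k y)
    (hP : ∀ a, ∀ k ∈ s, ∀ k' ∈ s, k < k' → P a (τ k) k' = 0)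
    (hP1 : ∀ a, ∀ k ∈ s, P a (τ k) k = 1)
    (hD : ∀ a, ∀ k ∈ s, ∀ k' ∈ s, k < k' → D a k' k = 0) (hDd : ∀ a, ∀ k ∈ s, D a k k ≠ 0)
    (hXr : ∀ x y, (fun a => X a x y) ∈ regularFunctions φ) (k : Fin n) (hk : k ∈ s) :
    (∀ y, (fun a => D a k y) ∈ regularFunctions φ) ∧
      ∀ x, (fun a => P a x k) ∈ regularFunctions φ := by
  have hsplit (k : Fin n) (hk : k ∈ s) (f : Fin n → ℂ) (hf : ∀ k' ∈ s, k < k' → f k' = 0) :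
      ∑ k' ∈ s, f k' = f k + ∑ k' ∈ s with k' < k, f k' := by
    rw [← Finset.sum_insert (by simp)]
    symm
    refine Finset.sum_subset ?_ fun k' hk' hn => hf k' hk' ?_
    · intro k'
      simp only [Finset.mem_insert, Finset.mem_filter]
      rintro (rfl | h)
      exacts [hk, h.1]
    · simp only [Finset.mem_insert, Finset.mem_filter, not_or, not_and, not_lt] at hn
      exact lt_of_le_of_ne (hn.2 hk') (Ne.symm hn.1)
  induction k using WellFoundedLT.induction with
  | ind k ih =>
    have ih' : ∀ k' ∈ s.filter (· < k), (∀ y, (fun a => D a k' y) ∈ regularFunctions φ) ∧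
        ∀ x, (fun a => P a x k') ∈ regularFunctions φ := fun k' hk' =>
      ih k' (Finset.mem_filter.1 hk').2 (Finset.mem_filter.1 hk').1
    -- In row `τ k` of `X` the terms with index above `k` vanish and `D a k y` has coefficient 1.
    -- The columns of `P` are then read off column `k` of `X`, with pivot `D a k k`.
    have hDr (y : Fin n) : (fun a => D a k y) ∈ regularFunctions φ := by
      have : (fun a => D a k y) =
          fun a => X a (τ k) y - ∑ k' ∈ s with k' < k, P a (τ k) k' * D a k' y := by
        ext a
        rw [hX, hsplit k hk _ fun k' hk' h => by rw [hP a k hk k' hk' h, zero_mul], hP1 a k hk]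
        ring
      rw [this]
      exact sub_mem_regularFunctions (hXr _ _) (sum_mul_mem_regularFunctions _
        (fun k' hk' => (ih' k' hk').2 _) fun k' hk' => (ih' k' hk').1 _)
    refine ⟨hDr, fun x => ?_⟩
    have : (fun a => P a x k) =
        fun a => (X a x k - ∑ k' ∈ s with k' < k, P a x k' * D a k' k) / D a k k := by
      ext a
      rw [eq_div_iff (hDd a k hk), hX,
        hsplit k hk _ fun k' hk' h => by rw [hD a k hk k' hk' h, mul_zero]]
      ring
    rw [this]
    exact div_mem_regularFunctions (sub_mem_regularFunctions (hXr _ _)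
      (sum_mul_mem_regularFunctions _ (fun k' hk' => (ih' k' hk').2 _)
        fun k' hk' => (ih' k' hk').1 _)) (hDr k) fun a => hDd a k hk

end Triangular

/-! ### The slice and the regularity of its parametrization in both directions. -/

section Slice

variable {n : ℕ} (σ : Equiv.Perm (Fin n))

/-- The right ends of the arcs of the link pattern. -/
def rightEnds : Finset (Fin n) := Finset.univ.filter fun k => σ k < k

/-- The positions of the free entries of the slice of matrices parametrizing the orbit. -/
def slicePositions : Finset (Fin n × Fin n) :=
  Finset.univ.filter fun p =>
    -- In a left-end column, a left-end row is free only if its arc strictly encloses the arc of the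
    -- column. In any other column, exactly the right-end rows on or above the diagonal are free.
    if p.2 < σ p.2 then p.1 < p.2 ∧ (p.1 < σ p.1 → σ p.2 < σ p.1) else σ p.1 < p.1 ∧ p.1 ≤ p.2

/-- The matrix with prescribed entries in the free positions, and the entries of the identity matrix
elsewhere. -/
def sliceMatrix (t : slicePositions σ → ℂ) : Matrix (Fin n) (Fin n) ℂ :=
  Matrix.of fun x y => if h : (x, y) ∈ slicePositions σ then t ⟨(x, y), h⟩ else
    (1 : Matrix (Fin n) (Fin n) ℂ) x y

/-- The free positions on the diagonal. -/
def IsDiagonal (k : slicePositions σ) : Prop := k.1.1 = k.1.2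

/-- The parametrization of the Borel orbit of `N_σ`. -/
noncomputable def orbitMap (t : CoordNeZero (IsDiagonal σ)) : Matrix (Fin n) (Fin n) ℂ :=
  sliceMatrix σ t.1 * nilMatrix σ * (sliceMatrix σ t.1)⁻¹

variable {σ}

theorem mem_slicePositions {x y : Fin n} : (x, y) ∈ slicePositions σ ↔
    if y < σ y then x < y ∧ (x < σ x → σ y < σ x) else σ x < x ∧ x ≤ y := by
  simp [slicePositions]

theorem sliceMatrix_of_notMem (t : slicePositions σ → ℂ) {x y : Fin n}
    (h : (x, y) ∉ slicePositions σ) :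
    sliceMatrix σ t x y = (1 : Matrix (Fin n) (Fin n) ℂ) x y := by
  simp [sliceMatrix, h]

theorem sliceMatrix_of_mem (t : slicePositions σ → ℂ) {x y : Fin n}
    (h : (x, y) ∈ slicePositions σ) : sliceMatrix σ t x y = t ⟨(x, y), h⟩ := by
  simp [sliceMatrix, h]

theorem sliceMatrix_upper (t : slicePositions σ → ℂ) (x y : Fin n) (h : y < x) :
    sliceMatrix σ t x y = 0 := by
  rw [sliceMatrix_of_notMem, Matrix.one_apply_ne h.ne']
  rw [mem_slicePositions]
  split_ifs
  · exact fun h' => h.asymm h'.1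
  · exact fun h' => h.not_ge h'.2

theorem sliceMatrix_diag_ne_zero (t : CoordNeZero (IsDiagonal σ)) (x : Fin n) :
    sliceMatrix σ t.1 x x ≠ 0 := by
  by_cases h : (x, x) ∈ slicePositions σ
  · rw [sliceMatrix_of_mem _ h]
    exact t.2 _ rfl
  · rw [sliceMatrix_of_notMem _ h]
    simp

theorem regular_sliceMatrix (x y : Fin n) : (fun t : CoordNeZero (IsDiagonal σ) =>
    sliceMatrix σ t.1 x y) ∈
      regularFunctions (Subtype.val : CoordNeZero (IsDiagonal σ) → slicePositions σ → ℂ) := by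
  by_cases h : (x, y) ∈ slicePositions σ
  · simp only [sliceMatrix_of_mem _ h]
    exact coord_mem_regularFunctions _ _
  · simp only [sliceMatrix_of_notMem _ h]
    exact const_mem_regularFunctions _ _

theorem mul_nilMatrix_apply (hσ : ∀ i, σ (σ i) = i) (A : Matrix (Fin n) (Fin n) ℂ)
    (x k : Fin n) : (A * nilMatrix σ) x k = if σ k < k then A x (σ k) else 0 := by
  rw [Matrix.mul_apply, Finset.sum_eq_single (σ k)]
  · simp [nilMatrix, hσ]
  · intro z _ hz
    have : σ z ≠ k := fun h => hz (by rw [← h, hσ])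
    simp [nilMatrix, this]
  · simp

theorem mul_nilMatrix_mul_apply (hσ : ∀ i, σ (σ i) = i) (A D : Matrix (Fin n) (Fin n) ℂ)
    (x y : Fin n) : (A * nilMatrix σ * D) x y = ∑ k ∈ rightEnds σ, A x (σ k) * D k y := by
  simp only [Matrix.mul_apply (M := A * nilMatrix σ), mul_nilMatrix_apply hσ, rightEnds,
    Finset.sum_filter, ite_mul, zero_mul]

theorem regular_orbitMap (hσ : ∀ i, σ (σ i) = i) (ij : Fin n × Fin n) :
    (fun t => orbitMap σ t ij.1 ij.2) ∈
      regularFunctions (Subtype.val : CoordNeZero (IsDiagonal σ) → slicePositions σ → ℂ) := by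
  have hinv := regular_inv_of_upper (fun t : CoordNeZero (IsDiagonal σ) => sliceMatrix σ t.1)
    (fun t => sliceMatrix_upper t.1) sliceMatrix_diag_ne_zero regular_sliceMatrix
  simp only [orbitMap, mul_nilMatrix_mul_apply hσ]
  exact sum_mul_mem_regularFunctions (rightEnds σ)
    (f := fun (t : CoordNeZero (IsDiagonal σ)) k => sliceMatrix σ t.1 ij.1 (σ k))
    (g := fun t k => (sliceMatrix σ t.1)⁻¹ k ij.2)
    (fun k _ => regular_sliceMatrix ij.1 (σ k)) fun k _ => hinv k ij.2

/-- Elimination yields the left-end columns of the slice matrix `S` and the right-end rows of `S⁻¹`.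
The other columns of `S` then follow by back substitution in the right-end rows of `S⁻¹ * S = 1`,
since their entries in all other rows are constant. -/
theorem regular_coord_of_orbitMap (hσ : ∀ i, σ (σ i) = i) (k : slicePositions σ) :
    (fun t : CoordNeZero (IsDiagonal σ) => t.1 k) ∈
      regularFunctions (fun t (ij : Fin n × Fin n) => orbitMap σ t ij.1 ij.2) := by
  set φ := fun (t : CoordNeZero (IsDiagonal σ)) (ij : Fin n × Fin n) => orbitMap σ t ij.1 ij.2
  have hlu := regular_of_lu (φ := φ) (rightEnds σ) σ (fun t x k => sliceMatrix σ t.1 x (σ k))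
    (fun t => (sliceMatrix σ t.1)⁻¹) (fun t => orbitMap σ t)
    (fun t x y => mul_nilMatrix_mul_apply hσ _ _ x y)
    (fun t k hk k' hk' h => by
      simp only [rightEnds, Finset.mem_filter, Finset.mem_univ, true_and] at hk hk'
      rw [sliceMatrix_of_notMem, Matrix.one_apply_ne]
      · exact fun h' => h.ne (σ.injective h')
      -- Freedom of the position `(σ k, σ k')` would require `k' < k`.
      · rw [mem_slicePositions, if_pos (by rwa [hσ]), hσ, hσ]
        exact fun h' => h.asymm (h'.2 hk))
    (fun t k hk => by
      simp only [rightEnds, Finset.mem_filter, Finset.mem_univ, true_and] at hk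
      rw [sliceMatrix_of_notMem, Matrix.one_apply_eq]
      rw [mem_slicePositions, if_pos (by rwa [hσ])]
      exact fun h' => h'.1.false)
    (fun t k _ k' _ h => inv_upper (sliceMatrix_upper t.1) (sliceMatrix_diag_ne_zero t) _ _ h)
    (fun t k _ => inv_diag_ne_zero (sliceMatrix_upper t.1) (sliceMatrix_diag_ne_zero t) k)
    (fun x y => coord_mem_regularFunctions φ (x, y))
  have hD : ∀ x ∈ {x | σ x < x}, ∀ z, (fun t : CoordNeZero (IsDiagonal σ) =>
      (sliceMatrix σ t.1)⁻¹ x z) ∈ regularFunctions φ := fun x hx z =>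
    (hlu x (Finset.mem_filter.2 ⟨Finset.mem_univ _, hx⟩)).1 z
  suffices h : ∀ x y, (fun t : CoordNeZero (IsDiagonal σ) => sliceMatrix σ t.1 x y) ∈
      regularFunctions φ by
    have := h k.1.1 k.1.2
    simpa only [sliceMatrix_of_mem _ k.2] using this
  intro x y
  by_cases hy : y < σ y
  · have := (hlu (σ y) (by simpa [rightEnds, hσ] using hy)).2 x
    simpa only [hσ] using this
  · refine regular_of_upper_system {x | σ x < x}
      (fun t : CoordNeZero (IsDiagonal σ) => (sliceMatrix σ t.1)⁻¹)
      (fun t z => sliceMatrix σ t.1 z y) (fun _ x => (1 : Matrix (Fin n) (Fin n) ℂ) x y)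
      (fun t x _ z h => inv_upper (sliceMatrix_upper t.1) (sliceMatrix_diag_ne_zero t) _ _ h)
      (fun t x _ => inv_diag_ne_zero (sliceMatrix_upper t.1) (sliceMatrix_diag_ne_zero t) x)
      (fun t x _ => ?_) hD
      (fun x _ => const_mem_regularFunctions φ _) (fun x hx => ?_) x
    · rw [← Matrix.mul_apply, Matrix.nonsing_inv_mul _
        (isUnit_det_of_upper (sliceMatrix_upper t.1) (sliceMatrix_diag_ne_zero t))]
    · have hnot : (x, y) ∉ slicePositions σ := by
        rw [mem_slicePositions, if_neg hy]
        exact fun h => hx h.1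
      simp only [sliceMatrix_of_notMem _ hnot]
      exact const_mem_regularFunctions φ _

end Slice

end LinkPattern

namespace LinkPattern

/-! ### Every point of the orbit comes from the slice. -/

variable {n : ℕ}

theorem mem_borelOrbit_iff {u v : Matrix (Fin n) (Fin n) ℂ} : v ∈ borelOrbit u ↔
    ∃ A : Matrix (Fin n) (Fin n) ℂ, (∀ i j, j < i → A i j = 0) ∧ (∀ i, A i i ≠ 0) ∧
      v = A * u * A⁻¹ := by
  constructor
  · rintro ⟨A, hA, rfl⟩
    refine ⟨A, hA, fun i => ?_, by rw [Matrix.coe_units_inv]⟩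
    have hdet := (Matrix.isUnit_iff_isUnit_det _).1 A.isUnit
    rw [Matrix.det_of_isUpperTriangular fun i j h => hA i j h, isUnit_iff_ne_zero] at hdet
    exact Finset.prod_ne_zero_iff.1 hdet i (Finset.mem_univ i)
  · rintro ⟨A, hA, hd, rfl⟩
    refine ⟨Matrix.nonsingInvUnit A (isUnit_det_of_upper hA hd), hA, ?_⟩
    rw [Matrix.coe_units_inv]
    rfl

/-- A right inverse of an upper triangular matrix on a set of rows, which agrees with the identity
matrix in the other rows. -/
theorem exists_partial_inverse {M : Matrix (Fin n) (Fin n) ℂ} (hM : ∀ i j, j < i → M i j = 0)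
    (hd : ∀ i, M i i ≠ 0) (S : Set (Fin n)) :
    ∃ H : Matrix (Fin n) (Fin n) ℂ, (∀ i j, j < i → H i j = 0) ∧ (∀ i, H i i ≠ 0) ∧
      (∀ x ∉ S, ∀ y, H x y = (1 : Matrix (Fin n) (Fin n) ℂ) x y) ∧
      ∀ x ∈ S, ∀ y, (M * H) x y = (1 : Matrix (Fin n) (Fin n) ℂ) x y := by
  classical
  let G : Matrix (Fin n) (Fin n) ℂ := Matrix.of fun x y => if x ∈ S then M x y else
    (1 : Matrix (Fin n) (Fin n) ℂ) x y
  have hG : ∀ i j, j < i → G i j = 0 := fun i j h => by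
    simp only [G, Matrix.of_apply, hM i j h, Matrix.one_apply_ne h.ne', ite_self]
  have hGd : ∀ i, G i i ≠ 0 := fun i => by
    simp only [G, Matrix.of_apply, Matrix.one_apply_eq]
    split_ifs
    exacts [hd i, one_ne_zero]
  have hmul (x y) : (G * G⁻¹) x y = (1 : Matrix (Fin n) (Fin n) ℂ) x y := by
    rw [Matrix.mul_nonsing_inv _ (isUnit_det_of_upper hG hGd)]
  refine ⟨G⁻¹, inv_upper hG hGd, inv_diag_ne_zero hG hGd, fun x hx y => ?_, fun x hx y => ?_⟩
  · rw [← hmul x y, Matrix.mul_apply]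
    simp [G, hx, Matrix.one_apply]
  · rw [← hmul x y, Matrix.mul_apply, Matrix.mul_apply]
    simp [G, hx]

variable {σ : Equiv.Perm (Fin n)}

theorem nilMatrix_mul_apply (A : Matrix (Fin n) (Fin n) ℂ) (x k : Fin n) :
    (nilMatrix σ * A) x k = if x < σ x then A (σ x) k else 0 := by
  rw [Matrix.mul_apply, Finset.sum_eq_single (σ x)]
  · simp [nilMatrix]
  · intro z _ hz
    simp [nilMatrix, hz.symm]
  · simp

/-- Multiplication by an element of the centralizer of `N_σ` reduces the columns of the left ends of
the arcs. -/
theorem exists_reduced_left_columns (hσ : ∀ i, σ (σ i) = i) {A : Matrix (Fin n) (Fin n) ℂ}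
    (hA : ∀ i j, j < i → A i j = 0) (hd : ∀ i, A i i ≠ 0) :
    ∃ A' : Matrix (Fin n) (Fin n) ℂ, (∀ i j, j < i → A' i j = 0) ∧ (∀ i, A' i i ≠ 0) ∧
      A' * nilMatrix σ * A'⁻¹ = A * nilMatrix σ * A⁻¹ ∧
      ∀ x y, y < σ y → x < σ x → x ≤ y → σ x ≤ σ y →
        A' x y = (1 : Matrix (Fin n) (Fin n) ℂ) x y := by
  choose H hHu hHd hH1 hH2 using fun y : Fin n =>
    exists_partial_inverse hA hd {x | x < σ x ∧ x ≤ y ∧ σ x ≤ σ y}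
  -- Column `y` of a left end is chosen so that `A * Z` has the required entries there. Commuting
  -- with `N` dictates the right-end columns, which are copies of the left-end ones with rows
  -- relabelled by `σ`.
  let Z : Matrix (Fin n) (Fin n) ℂ := Matrix.of fun x y => if y < σ y then H y x y else
    if σ y < y then H (σ y) (σ x) (σ y) else (1 : Matrix (Fin n) (Fin n) ℂ) x y
  have hZu : ∀ i j, j < i → Z i j = 0 := by
    intro x y h
    simp only [Z, Matrix.of_apply]
    split_ifs with h1 h2
    · exact hHu y x y h
    · rw [hH1, Matrix.one_apply_ne (fun h' => h.ne' (σ.injective h'))]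
      simp only [Set.mem_ofPred_eq, hσ]
      exact fun h' => h.not_ge h'.2.2
    · exact Matrix.one_apply_ne h.ne'
  have hZd : ∀ i, Z i i ≠ 0 := by
    intro x
    simp only [Z, Matrix.of_apply]
    split_ifs with h1 h2
    · exact hHd x x
    · exact hHd _ _
    · simp
  have hcomm : Z * nilMatrix σ = nilMatrix σ * Z := by
    ext x k
    rw [mul_nilMatrix_apply hσ, nilMatrix_mul_apply]
    simp only [Z, Matrix.of_apply, hσ]
    rcases lt_trichotomy (σ k) k with hk | hk | hk
    · rw [if_pos hk, if_pos hk, if_neg hk.not_gt, if_pos hk]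
      split_ifs with hx
      · rfl
      · rw [hH1 _ x fun h => hx h.1, Matrix.one_apply_ne]
        rintro rfl
        exact hx (by rwa [hσ])
    · rw [if_neg hk.not_lt, if_neg hk.not_gt, if_neg hk.not_lt]
      split_ifs with hx
      · rw [Matrix.one_apply_ne]
        rintro rfl
        rw [hσ] at hk
        exact hx.ne hk
      · rfl
    · rw [if_neg hk.not_gt, if_pos hk]
      split_ifs with hx
      · rw [hH1 _ (σ x), Matrix.one_apply_ne]
        · rintro rfl
          rw [hσ] at hk
          exact hx.asymm hk
        · rw [Set.mem_ofPred_eq, hσ]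
          exact fun h => hx.asymm h.1
      · rfl
  have hZ := isUnit_det_of_upper hZu hZd
  refine ⟨A * Z, ?_, fun i => ?_, ?_, ?_⟩
  · have hA' : A.BlockTriangular id := fun i j h => hA i j h
    have hZ' : Z.BlockTriangular id := fun i j h => hZu i j h
    exact fun i j h => (hA'.mul hZ') h
  · rw [mul_diag_of_upper hA hZu]
    exact mul_ne_zero (hd i) (hZd i)
  · rw [Matrix.mul_inv_rev, Matrix.mul_assoc A Z, hcomm, Matrix.mul_assoc, Matrix.mul_assoc,
      Matrix.mul_nonsing_inv_cancel_left _ _ hZ, Matrix.mul_assoc]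
  · intro x y hy hx hxy hxy'
    rw [← hH2 y x ⟨hx, hxy, hxy'⟩ y, Matrix.mul_apply, Matrix.mul_apply]
    simp [Z, hy]

/-- After the centralizer has reduced the left-end columns, the remaining columns are exchanged for
ones on which the right-end rows of `A₁⁻¹` act as in the identity. The conjugate of `N` does not
change, because it involves no other rows of the inverse. -/
theorem range_orbitMap (hσ : ∀ i, σ (σ i) = i) :
    Set.range (orbitMap σ) = borelOrbit (nilMatrix σ) := by
  ext v
  rw [mem_borelOrbit_iff]
  constructor
  · rintro ⟨t, rfl⟩
    exact ⟨sliceMatrix σ t.1, sliceMatrix_upper t.1, sliceMatrix_diag_ne_zero t, rfl⟩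
  rintro ⟨A₀, hA₀, hd₀, rfl⟩
  obtain ⟨A₁, hA₁, hd₁, hconj, hred⟩ := exists_reduced_left_columns hσ hA₀ hd₀
  have hdet₁ := isUnit_det_of_upper hA₁ hd₁
  obtain ⟨H, hHu, hHd, hH1, hH2⟩ := exists_partial_inverse (inv_upper hA₁ hd₁)
    (inv_diag_ne_zero hA₁ hd₁) {x | σ x < x}
  let A : Matrix (Fin n) (Fin n) ℂ := Matrix.of fun x y => if y < σ y then A₁ x y else H x y
  have hA : ∀ i j, j < i → A i j = 0 := fun i j h => by
    simp only [A, Matrix.of_apply, hA₁ i j h, hHu i j h, ite_self]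
  have hd : ∀ i, A i i ≠ 0 := fun i => by
    simp only [A, Matrix.of_apply]
    split_ifs
    exacts [hd₁ i, hHd i]
  have hDA : ∀ k ∈ rightEnds σ, ∀ y, (A₁⁻¹ * A) k y = (1 : Matrix (Fin n) (Fin n) ℂ) k y := by
    intro k hk y
    by_cases hy : y < σ y
    · rw [← Matrix.nonsing_inv_mul _ hdet₁, Matrix.mul_apply, Matrix.mul_apply]
      simp [A, hy]
    · rw [← hH2 k (by simpa [rightEnds] using hk) y, Matrix.mul_apply, Matrix.mul_apply]
      simp [A, hy]
  -- Only the right-end rows of `A₁⁻¹ * A` enter the left side, and only the left-end columns,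
  -- shared by `A` and `A₁`, enter the right side.
  have hint : A₁ * nilMatrix σ * (A₁⁻¹ * A) = A * nilMatrix σ := by
    ext x y
    rw [mul_nilMatrix_mul_apply hσ, mul_nilMatrix_apply hσ,
      Finset.sum_congr rfl fun k hk => by rw [hDA k hk y]]
    simp only [Matrix.one_apply, mul_ite, mul_one, mul_zero, Finset.sum_ite_eq', rightEnds,
      Finset.mem_filter, Finset.mem_univ, true_and]
    split_ifs with hy
    · simp [A, hσ, hy]
    · rfl
  have hslice : sliceMatrix σ (fun k => A k.1.1 k.1.2) = A := by
    ext x y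
    by_cases h : (x, y) ∈ slicePositions σ
    · rw [sliceMatrix_of_mem _ h]
    · rw [sliceMatrix_of_notMem _ h]
      rw [mem_slicePositions] at h
      rcases lt_or_ge y x with hxy | hxy
      · rw [hA x y hxy, Matrix.one_apply_ne hxy.ne']
      simp only [A, Matrix.of_apply]
      split_ifs at h ⊢ with hy
      · rcases eq_or_lt_of_le hxy with rfl | hlt
        · exact (hred x x hy hy le_rfl le_rfl).symm
        · have hx : ¬ (x < σ x → σ y < σ x) := fun h' => h ⟨hlt, h'⟩
          push Not at hx
          exact (hred x y hy hx.1 hxy hx.2).symm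
      · exact (hH1 x (fun hx => h ⟨hx, hxy⟩) y).symm
  refine ⟨⟨fun k => A k.1.1 k.1.2, fun k (hk : k.1.1 = k.1.2) => ?_⟩, ?_⟩
  · change A k.1.1 k.1.2 ≠ 0
    rw [hk]
    exact hd _
  · rw [orbitMap, hslice, ← hconj, ← hint, ← Matrix.mul_assoc,
      Matrix.mul_nonsing_inv_cancel_right _ _ (isUnit_det_of_upper hA hd)]

end LinkPattern

namespace LinkPattern

/-! ### Counting the free positions. -/

section Count

variable {n : ℕ} {σ : Equiv.Perm (Fin n)}

theorem card_rightEnds (hσ : ∀ i, σ (σ i) = i) : (rightEnds σ).card = length σ := by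
  refine Finset.card_nbij' (fun k => (σ k, k)) Prod.snd ?_ ?_ ?_ ?_
  · intro k
    simp [rightEnds, arcs, hσ]
  · rintro ⟨i, j⟩
    simp only [arcs, rightEnds, Finset.coe_filter, Finset.mem_univ, true_and, Set.mem_ofPred_eq]
    rintro ⟨h, rfl⟩
    rwa [hσ]
  · intro k _
    rfl
  · rintro ⟨i, j⟩
    simp only [arcs, Finset.coe_filter, Finset.mem_univ, true_and, Set.mem_ofPred_eq]
    rintro ⟨h, rfl⟩
    rw [hσ]

theorem card_leftEnds :
    (Finset.univ.filter fun k => k < σ k).card = length σ := by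
  refine Finset.card_nbij' (fun k => (k, σ k)) Prod.fst ?_ ?_ ?_ ?_
  · intro k
    simp [arcs]
  · rintro ⟨i, j⟩
    simp only [arcs, Finset.coe_filter, Finset.mem_univ, true_and, Set.mem_ofPred_eq]
    rintro ⟨h, rfl⟩
    exact h
  · intro k _
    rfl
  · rintro ⟨i, j⟩
    simp only [arcs, Finset.coe_filter, Finset.mem_univ, true_and, Set.mem_ofPred_eq]
    rintro ⟨h, rfl⟩
    rfl

/-- All three sets consist of pairs of a right end and a point that is not a left end. They encode
the free positions in columns that are not left ends, those in left-end columns with a row that is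
not a left end, and those with row and column both left ends, that is, nested arcs. -/
theorem card_slicePositions_split (hσ : ∀ i, σ (σ i) = i) : (slicePositions σ).card =
    (Finset.univ.filter fun p : Fin n × Fin n => σ p.1 < p.1 ∧ ¬ p.2 < σ p.2 ∧ p.1 ≤ p.2).card +
    (Finset.univ.filter fun p : Fin n × Fin n =>
      σ p.1 < p.1 ∧ ¬ p.2 < σ p.2 ∧ p.2 < σ p.1).card +
    (Finset.univ.filter fun p : Fin n × Fin n =>
      σ p.1 < p.1 ∧ σ p.2 < p.2 ∧ p.2 < p.1 ∧ σ p.1 < σ p.2).card := by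
  rw [← Finset.card_filter_add_card_filter_not (s := slicePositions σ) fun p => ¬ p.2 < σ p.2,
    ← Finset.card_filter_add_card_filter_not
      (s := (slicePositions σ).filter fun p => ¬ ¬ p.2 < σ p.2) fun p => ¬ p.1 < σ p.1, ← add_assoc]
  congr 1
  · congr 1
    · congr 1
      ext ⟨x, y⟩
      simp only [Finset.mem_filter, mem_slicePositions, Finset.mem_univ, true_and]
      split_ifs <;> tauto
    · refine Finset.card_nbij' (fun p => (σ p.2, p.1)) (fun p => (p.2, σ p.1)) ?_ ?_ ?_ ?_
      · rintro ⟨x, y⟩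
        simp only [Finset.coe_filter, Finset.mem_filter, mem_slicePositions, Finset.mem_univ,
          true_and, Set.mem_ofPred_eq, hσ]
        split_ifs <;> tauto
      · rintro ⟨x, y⟩
        simp only [Finset.coe_filter, Finset.mem_filter, mem_slicePositions, Finset.mem_univ,
          true_and, Set.mem_ofPred_eq, hσ]
        split_ifs <;> tauto
      · rintro ⟨x, y⟩ _
        simp [hσ]
      · rintro ⟨x, y⟩ _
        simp [hσ]
  · refine Finset.card_nbij' (fun p => (σ p.1, σ p.2)) (fun p => (σ p.1, σ p.2)) ?_ ?_ ?_ ?_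
    · rintro ⟨x, y⟩
      simp only [Finset.coe_filter, Finset.mem_filter, mem_slicePositions, Finset.mem_univ,
        true_and, Set.mem_ofPred_eq, hσ]
      split_ifs <;> tauto
    · rintro ⟨x, y⟩
      simp only [Finset.coe_filter, Finset.mem_filter, mem_slicePositions, Finset.mem_univ,
        true_and, Set.mem_ofPred_eq, hσ]
      split_ifs <;> tauto
    · rintro ⟨x, y⟩ _
      simp [hσ]
    · rintro ⟨x, y⟩ _
      simp [hσ]

theorem crossings_eq (hσ : ∀ i, σ (σ i) = i) : crossings σ =
    (Finset.univ.filter fun p : Fin n × Fin n =>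
      σ p.1 < p.1 ∧ σ p.2 < σ p.1 ∧ σ p.1 < p.2 ∧ p.2 < p.1).card := by
  refine Finset.card_nbij' (fun p => (p.2.2, p.1.2)) (fun p => ((σ p.2, p.2), (σ p.1, p.1)))
    ?_ ?_ ?_ ?_
  · rintro ⟨⟨i, j⟩, ⟨i', j'⟩⟩
    simp only [arcs, Finset.coe_filter, Finset.mem_product, Finset.mem_filter, Finset.mem_univ,
      true_and, Set.mem_ofPred_eq]
    rintro ⟨⟨⟨h1, rfl⟩, h2, rfl⟩, h⟩
    simpa only [hσ] using ⟨h2, h⟩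
  · rintro ⟨a, b⟩
    simp only [arcs, Finset.coe_filter, Finset.mem_product, Finset.mem_filter, Finset.mem_univ,
      true_and, Set.mem_ofPred_eq, hσ]
    rintro ⟨h1, h2, h3, h4⟩
    exact ⟨⟨⟨h2.trans h3, trivial⟩, h1, trivial⟩, h2, h3, h4⟩
  · rintro ⟨⟨i, j⟩, ⟨i', j'⟩⟩
    simp only [arcs, Finset.coe_filter, Finset.mem_product, Finset.mem_filter, Finset.mem_univ,
      true_and, Set.mem_ofPred_eq]
    rintro ⟨⟨⟨h1, rfl⟩, h2, rfl⟩, h⟩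
    simp [hσ]
  · rintro ⟨a, b⟩ _
    rfl

theorem fixedUnder_eq (hσ : ∀ i, σ (σ i) = i) : fixedUnder σ =
    (Finset.univ.filter fun p : Fin n × Fin n =>
      σ p.2 = p.2 ∧ σ p.1 < p.2 ∧ p.2 < p.1).card := by
  rw [Finset.card_eq_sum_card_fiberwise (f := Prod.snd) (t := fixedPts σ)]
  · refine Finset.sum_congr rfl fun b hb => ?_
    simp only [fixedPts, Finset.mem_filter, Finset.mem_univ, true_and] at hb
    refine Finset.card_nbij' (fun p => (p.2, b)) (fun p => (σ p.1, p.1)) ?_ ?_ ?_ ?_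
    · rintro ⟨i, j⟩
      simp only [arcs, Finset.coe_filter, Finset.mem_filter, Finset.mem_univ,
        true_and, Set.mem_ofPred_eq]
      rintro ⟨⟨h1, rfl⟩, h⟩
      simpa only [hσ, and_true] using ⟨hb, h⟩
    · rintro ⟨a, b'⟩
      simp only [arcs, Finset.coe_filter, Finset.mem_filter, Finset.mem_univ,
        true_and, Set.mem_ofPred_eq, hσ]
      rintro ⟨⟨_, h⟩, rfl⟩
      exact ⟨⟨h.1.trans h.2, trivial⟩, h⟩
    · rintro ⟨i, j⟩
      simp only [arcs, Finset.coe_filter, Finset.mem_filter, Finset.mem_univ,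
        true_and, Set.mem_ofPred_eq]
      rintro ⟨⟨h1, rfl⟩, h⟩
      simp [hσ]
    · rintro ⟨a, b'⟩
      simp only [Finset.coe_filter, Finset.mem_filter, Finset.mem_univ, true_and,
        Set.mem_ofPred_eq]
      rintro ⟨_, rfl⟩
      rfl
  · rintro ⟨a, b⟩
    simp only [fixedPts, Finset.coe_filter, Finset.mem_univ, true_and, Set.mem_ofPred_eq]
    exact fun h => h.1

/-- Let `a` be a right end and `b` not a left end. If `a ≤ b`, or `b < σ a`, or the arc ending at
`b` is nested in that ending at `a`, the pair is a free position. Otherwise `σ a < b < a`, and `b`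
is either fixed or the right end of an arc crossing that of `a`. -/
theorem card_slicePositions_add (hσ : ∀ i, σ (σ i) = i) :
    (slicePositions σ).card + crossings σ + fixedUnder σ =
      length σ * (Finset.univ.filter fun k => ¬ k < σ k).card := by
  rw [card_slicePositions_split hσ, crossings_eq hσ, fixedUnder_eq hσ, ← card_rightEnds hσ,
    ← Finset.card_product, rightEnds, ← Finset.filter_product, Finset.univ_product_univ]
  simp only [Finset.card_filter, ← Finset.sum_add_distrib]
  refine Finset.sum_congr rfl fun p _ => ?_
  obtain ⟨a, b⟩ := p
  -- With `h1` and `h2` recorded, the images of `a` and `b` can be treated as arbitrary points, and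
  -- the pairwise identity becomes a case check on the order of four numbers.
  have h1 : σ a = b → σ b = a := fun h => by rw [← h, hσ]
  have h2 : σ a = σ b → a = b := fun h => σ.injective h
  generalize σ a = a' at *
  generalize σ b = b' at *
  dsimp only
  split_ifs <;> omega

theorem card_slicePositions (hσ : ∀ i, σ (σ i) = i) : ((slicePositions σ).card : ℤ) =
    length σ * ((n : ℤ) - length σ) - crossings σ - fixedUnder σ := by
  have h := card_slicePositions_add hσ
  have h' := Finset.card_filter_add_card_filter_not (s := (Finset.univ : Finset (Fin n)))
    fun k => k < σ k
  rw [card_leftEnds, Finset.card_univ, Fintype.card_fin] at h'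
  zify at h h'
  rw [← h', add_sub_cancel_left, ← h]
  ring

end Count

end LinkPattern

theorem theorem3p1 (n : ℕ) (σ : Equiv.Perm (Fin n)) (hσ : σ ^ 2 = 1) :
    ∃ d : ℕ,
      LinkPattern.zariskiDim (LinkPattern.borelOrbit (LinkPattern.nilMatrix σ)) = d ∧
      (d : ℤ) = LinkPattern.length σ * ((n : ℤ) - LinkPattern.length σ)
        - LinkPattern.crossings σ - LinkPattern.fixedUnder σ := by
  have hσ' : ∀ i, σ (σ i) = i := fun i => by
    simpa [sq] using congrArg (fun τ : Equiv.Perm (Fin n) => τ i) hσ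
  refine ⟨(LinkPattern.slicePositions σ).card, ?_, LinkPattern.card_slicePositions hσ'⟩
  rw [← LinkPattern.range_orbitMap hσ', LinkPattern.zariskiDim_eq_card _ _
    (LinkPattern.regular_orbitMap hσ') (LinkPattern.regular_coord_of_orbitMap hσ'),
    Fintype.card_coe]
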